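/- **Setting.** Let $K\ge 1$ and let $P_1,\dots,P_K$ be probability distributions on $\mathbb R$ (arms) such that, for some fixed $p>2$, every arm has a finite $p$-th moment; let $\mu_k$ be the mean of $P_k$. Let the data $\mathcal D^*_\infty=(X^*,W_{-1},W_0,W_1,\dots)$ consist of independent random elements: a table with entries $X^*_{i,k}\sim P_k$ ($i\ge 1$, $k\in[K]$), an external random element $W_{-1}$ with arbitrary law on an arbitrary measurable space, and seeds $W_t\sim U[0,1]$ ($t\ge 0$). Let $\nu_t(k\mid\cdot)\ge 0$, $\sum_k\nu_t(k\mid \cdot)=1$, be measurable functions of $W_{-1}$ and of the previous data $A_1,Y_1,\dots,A_{t-1},Y_{t-1}$ (a sampling rule). In round $t\ge 1$ one pulls the arm $A_t=k$ for which $W_{t-1}\in\big(\sum_{j<k}\nu_t(j),\sum_{j\le k}\nu_t(j)\big)$ and observes $Y_t=X^*_{N_k(t),k}$, where $N_k(t)=\sum_{s\le t}\mathbf 1(A_s=k)$. Put $S_k(t)=\sum_{s\le t}\mathbf 1(A_s=k)Y_s$, $\hat\mu_k(t)=S_k(t)/N_k(t)$ and $\mathcal F_t=\sigma(W_{-1},W_0,Y_1,W_1,\dots,Y_t,W_t)$.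 Let $\mathcal T$ be a stopping time of $(\mathcal F_t)$ with values in $\{0,1,2,\dots\}\cup\{\infty\}$, and let the chosen arm $\kappa\in[K]$ be $\mathcal F_{\mathcal T}$-measurable. On $\{\mathcal T=\infty\}$ put $N_k(\mathcal T)=\sup_t N_k(t)$ and $\hat\mu_k(\mathcal T)=\lim_{t\to\infty}\hat\mu_k(t)$ (the limit exists a.s. on $\{\mathcal T=\infty,\ N_k(\mathcal T)\ge 1\}$), and read $1/\infty=0$. **Monotonicity.** A function $f$ of $\mathcal D^*_\infty$ is called increasing (decreasing) in the entry $(i,k)$ if, for almost every $\mathcal D^*_\infty$ and $P_k$-almost every $x\ge X^*_{i,k}$, replacing the entry $X^*_{i,k}$ by $x$ and keeping everything else fixed does not decrease (does not increase) $f$. The strategy is *monotonically increasing (decreasing)* if for all $i,k$ the function $\mathbf 1(\kappa=k)/N_k(\mathcal T)$ is increasing (decreasing) in the entry $(i,k)$. It has an *optimistic sampling rule* if $N_k(t)$ is increasing in the entry $(i,k)$ for all $i,t,k$; an *optimistic stopping rule* if $\mathcal T$ is decreasing in the entry $(i,k)$ for all $i,k$; an *optimistic choosing rule* if $\mathbf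 1(\kappa=k)$ is increasing in the entry $(i,k)$ for all $i,k$. Sampling (all $A_t$), stopping ($\mathcal T$) or choosing ($\kappa$) is *nonadaptive* if it is a.s. a function of $W_{-1},W_0,W_1,\dots$ only. **Claim.** Suppose that for every $k$ with $\mathbb P(\kappa=k)>0$ we have $N_k(\mathcal T)\ge 1$ a.s. (no assumption is made on $\mathbb E N_k(\mathcal T)$). Then $\hat\mu_\kappa(\mathcal T)$ is integrable, and: 1. If the strategy is monotonically decreasing, or if it has an optimistic sampling rule with nonadaptive stopping and choosing, then $$\mathbb E[\hat\mu_\kappa(\mathcal T)\mid\kappa=k]\le\mu_k\quad\text{for all }k\text{ with }\mathbb P(\kappa=k)>0,\qquad\text{and}\qquad \mathbb E[\hat\mu_\kappa(\mathcal T)-\mu_\kappa]\le 0.$$ 2. If the strategy is monotonically increasing, or if it has an optimistic stopping rule with nonadaptive sampling and choosing, or an optimistic choosing rule with nonadaptive sampling and stopping, then $$\mathbb E[\hat\mu_\kappa(\mathcal T)\mid\kappa=k]\ge\mu_k\quad\text{for all }k\text{ with }\mathbb P(\kappa=k)>0,\qquad\text{and}\qquad \mathbb E[\hat\mu_\kappa(\mathcal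 T)-\mu_\kappa]\ge 0.$$ -/

import Mathlib

open MeasureTheory ProbabilityTheory Filter
open scoped ENNReal Topology

namespace Bandit

noncomputable section

/-- A realization of the complete tabular data `(X*, W₋₁, (W₀, W₁, W₂, …))`. The table entry at
`(i, k)` is the `(i + 1)`-st draw from arm `k`, `E` is the space of the external randomness `W₋₁`,
and every seed `W_t` lies in `[0, 1]`. -/
abbrev Dataset (K : ℕ) (E : Type*) : Type _ :=
  (ℕ × Fin K → ℝ) × E × (ℕ → unitInterval)

namespace Dataset

variable {K : ℕ} {E : Type*}

/-- The dataset with the table entry `(i, k)` replaced by `x`, all else being kept. -/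
def setEntry (D : Dataset K E) (i : ℕ) (k : Fin K) (x : ℝ) : Dataset K E :=
  (Function.update D.1 (i, k) x, D.2)

/-- The law of the data: independent table entries `X*_{i,k} ∼ P k`, an external random
element `W₋₁ ∼ Q`, and independent uniform seeds `W_t`, all independent. -/
def law [MeasurableSpace E] (P : Fin K → Measure ℝ) [∀ k, IsProbabilityMeasure (P k)]
    (Q : Measure E) : Measure (Dataset K E) :=
  (Measure.infinitePi fun p : ℕ × Fin K => P p.2).prod
    (Q.prod (Measure.infinitePi fun _ : ℕ => (volume : Measure unitInterval)))

end Dataset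

/-- A sampling rule: `prob t w h k` is the conditional probability `ν_{t+1}(k ∣ 𝒟_t)` of pulling
arm `k` in round `t + 1`, given the external randomness `w` and the previous data
`h = (A₁, Y₁, …, A_t, Y_t)`. -/
structure SamplingRule (K : ℕ) (E : Type*) [MeasurableSpace E] where
  prob : (t : ℕ) → E → (Fin t → Fin K × ℝ) → Fin K → ℝ
  prob_nonneg : ∀ t w h k, 0 ≤ prob t w h k
  sum_prob : ∀ t w h, ∑ k, prob t w h k = 1
  measurable_prob : ∀ t k,
    Measurable fun q : E × (Fin t → Fin K × ℝ) => prob t q.1 q.2 k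

/-- The arm `k` for which `u` lies in the open interval `(∑_{j < k} ν j, ∑_{j ≤ k} ν j)`. For the
finitely many `u` that lie in no such interval the value is the arm `0`. -/
def pick {K : ℕ} [NeZero K] (ν : Fin K → ℝ) (u : ℝ) : Fin K :=
  open Classical in
  if h : ∃ k, ∑ j ∈ Finset.Iio k, ν j < u ∧ u < ∑ j ∈ Finset.Iic k, ν j then h.choose else 0

lemma pick_eq_of_mem {K : ℕ} [NeZero K] {ν : Fin K → ℝ} (hν : ∀ k, 0 ≤ ν k) {u : ℝ} {k : Fin K}
    (h₁ : ∑ j ∈ Finset.Iio k, ν j < u) (h₂ : u < ∑ j ∈ Finset.Iic k, ν j) : pick ν u = k := by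
  have hex : ∃ k, ∑ j ∈ Finset.Iio k, ν j < u ∧ u < ∑ j ∈ Finset.Iic k, ν j := ⟨k, h₁, h₂⟩
  have aux : ∀ a b : Fin K, a < b → ∑ j ∈ Finset.Iic a, ν j ≤ ∑ j ∈ Finset.Iio b, ν j := by
    intro a b hab
    refine Finset.sum_le_sum_of_subset_of_nonneg ?_ fun j _ _ => hν j
    intro j hj
    rw [Finset.mem_Iic] at hj
    rw [Finset.mem_Iio]
    exact lt_of_le_of_lt hj hab
  rw [pick, dif_pos hex]
  obtain ⟨h₃, h₄⟩ := hex.choose_spec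
  rcases lt_trichotomy hex.choose k with h | h | h
  · linarith [aux _ _ h]
  · exact h
  · linarith [aux _ _ h]

namespace SamplingRule

variable {K : ℕ} [NeZero K] {E : Type*} [MeasurableSpace E]

/-- The data `(A₁, Y₁, …, A_t, Y_t)` of the first `t` rounds. In round `t + 1` the seed `W_t`
selects the arm, and the observation is the first entry in the column of that arm that has not
been used yet. -/
def history (ν : SamplingRule K E) (D : Dataset K E) : (t : ℕ) → (Fin t → Fin K × ℝ)
  | 0 => Fin.elim0
  | t + 1 =>
    let h := history ν D t
    let a := pick (ν.prob t D.2.1 h) (D.2.2 t)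
    Fin.snoc (α := fun _ => Fin K × ℝ) h
      (a, D.1 ((Finset.univ.filter fun s : Fin t => (h s).1 = a).card, a))

/-- `ν.arm t` is the arm `A_{t+1}` pulled in round `t + 1`. -/
def arm (ν : SamplingRule K E) (t : ℕ) (D : Dataset K E) : Fin K :=
  (ν.history D (t + 1) (Fin.last t)).1

/-- `ν.obs t` is the observation `Y_{t+1}` of round `t + 1`. -/
def obs (ν : SamplingRule K E) (t : ℕ) (D : Dataset K E) : ℝ :=
  (ν.history D (t + 1) (Fin.last t)).2

/-- The number `N_k(t)` of draws from arm `k` in the first `t` rounds. -/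
def count (ν : SamplingRule K E) (k : Fin K) (t : ℕ) (D : Dataset K E) : ℕ :=
  ∑ s ∈ Finset.range t, if ν.arm s D = k then 1 else 0

/-- The sum `S_k(t)` of the observations from arm `k` in the first `t` rounds. -/
def sum (ν : SamplingRule K E) (k : Fin K) (t : ℕ) (D : Dataset K E) : ℝ :=
  ∑ s ∈ Finset.range t, if ν.arm s D = k then ν.obs s D else 0

/-- The sample mean `S_k(t) / N_k(t)` of arm `k` after `t` rounds. -/
def mean (ν : SamplingRule K E) (k : Fin K) (t : ℕ) (D : Dataset K E) : ℝ :=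
  ν.sum k t D / ν.count k t D

lemma measurable_pick :
    Measurable fun q : {ν : Fin K → ℝ // ∀ k, 0 ≤ ν k} × ℝ => pick q.1.1 q.2 := by
  have hS : ∀ (k : Fin K) (s : Finset (Fin K)), Measurable
      fun q : {ν : Fin K → ℝ // ∀ k, 0 ≤ ν k} × ℝ => ∑ j ∈ s, q.1.1 j := by
    intro k s
    refine Finset.measurable_sum _ fun j _ => ?_
    exact (measurable_pi_apply j).comp (measurable_subtype_coe.comp measurable_fst)
  let A : Fin K → Set ({ν : Fin K → ℝ // ∀ k, 0 ≤ ν k} × ℝ) := fun k =>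
    {q | ∑ j ∈ Finset.Iio k, q.1.1 j < q.2 ∧ q.2 < ∑ j ∈ Finset.Iic k, q.1.1 j}
  have hA : ∀ k, MeasurableSet (A k) := fun k =>
    (measurableSet_lt (hS k _) measurable_snd).inter (measurableSet_lt measurable_snd (hS k _))
  refine measurable_to_countable' fun k => ?_
  have : (fun q : {ν : Fin K → ℝ // ∀ k, 0 ≤ ν k} × ℝ => pick q.1.1 q.2) ⁻¹' {k} =
      A k ∪ ((⋃ j, A j)ᶜ ∩ {_q | (0 : Fin K) = k}) := by
    ext q
    simp only [Set.mem_preimage, Set.mem_singleton_iff, Set.mem_union, Set.mem_inter_iff,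
      Set.mem_compl_iff, Set.mem_iUnion, Set.mem_ofPred_eq]
    constructor
    · intro hq
      by_cases hex : ∃ j, q ∈ A j
      · obtain ⟨j, hj⟩ := hex
        left
        rw [pick_eq_of_mem q.1.2 hj.1 hj.2] at hq
        exact hq ▸ hj
      · right
        refine ⟨hex, ?_⟩
        rw [← hq, pick, dif_neg]
        exact hex
    · rintro (hq | ⟨hex, hk⟩)
      · exact pick_eq_of_mem q.1.2 hq.1 hq.2
      · rw [pick, dif_neg, hk]
        exact hex
  rw [this]
  exact (hA k).union ((MeasurableSet.iUnion hA).compl.inter (MeasurableSet.const _))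

lemma measurable_history (ν : SamplingRule K E) (t : ℕ) :
    Measurable fun D : Dataset K E => ν.history D t := by
  induction t with
  | zero => exact measurable_pi_lambda _ fun s => s.elim0
  | succ t ih =>
    have hp : Measurable fun D : Dataset K E =>
        pick (ν.prob t D.2.1 (ν.history D t)) (D.2.2 t) := by
      have h1 : Measurable fun D : Dataset K E =>
          ((⟨ν.prob t D.2.1 (ν.history D t), ν.prob_nonneg t _ _⟩ :
            {ν : Fin K → ℝ // ∀ k, 0 ≤ ν k}), ((D.2.2 t : unitInterval) : ℝ)) := by
        refine Measurable.prodMk (Measurable.subtype_mk (measurable_pi_lambda _ fun k => ?_)) ?_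
        · exact (ν.measurable_prob t k).comp
            ((measurable_fst.comp measurable_snd).prodMk ih)
        · exact measurable_subtype_coe.comp
            ((measurable_pi_apply t).comp (measurable_snd.comp measurable_snd))
      exact measurable_pick.comp h1
    have hc : Measurable fun D : Dataset K E =>
        (Finset.univ.filter fun s : Fin t => (ν.history D t s).1 =
          pick (ν.prob t D.2.1 (ν.history D t)) (D.2.2 t)).card := by
      simp only [Finset.card_filter]
      refine Finset.measurable_sum _ fun s _ => Measurable.ite ?_ measurable_const measurable_const
      exact measurableSet_eq_fun (measurable_fst.comp ((measurable_pi_apply s).comp ih)) hp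
    have hx : Measurable fun D : Dataset K E => D.1
        ((Finset.univ.filter fun s : Fin t => (ν.history D t s).1 =
          pick (ν.prob t D.2.1 (ν.history D t)) (D.2.2 t)).card,
          pick (ν.prob t D.2.1 (ν.history D t)) (D.2.2 t)) := by
      have h2 : Measurable fun r : (ℕ × Fin K → ℝ) × (ℕ × Fin K) => r.1 r.2 :=
        measurable_from_prod_countable_left fun p => measurable_pi_apply p
      exact h2.comp (measurable_fst.prodMk (hc.prodMk hp))
    refine measurable_pi_lambda _ fun s => ?_
    induction s using Fin.lastCases with
    | last =>
      simp only [history, Fin.snoc_last]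
      exact hp.prodMk hx
    | cast s =>
      simp only [history, Fin.snoc_castSucc]
      exact (measurable_pi_apply s).comp ih

lemma measurable_obs (ν : SamplingRule K E) (t : ℕ) : Measurable (ν.obs t) :=
  measurable_snd.comp ((measurable_pi_apply _).comp (ν.measurable_history (t + 1)))

/-- The natural filtration `ℱ_t = σ(W₋₁, W₀, Y₁, W₁, …, Y_t, W_t)`. -/
def filtration (ν : SamplingRule K E) :
    Filtration ℕ (inferInstance : MeasurableSpace (Dataset K E)) where
  seq t := MeasurableSpace.comap (fun D => D.2.1) inferInstance ⊔
    (⨆ s ≤ t, MeasurableSpace.comap (fun D => D.2.2 s) inferInstance) ⊔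
    (⨆ s < t, MeasurableSpace.comap (ν.obs s) inferInstance)
  mono' := by
    intro a b hab
    refine sup_le_sup (sup_le_sup le_rfl ?_) ?_
    · exact biSup_mono fun s hs => le_trans hs hab
    · exact biSup_mono fun s hs => lt_of_lt_of_le hs hab
  le' := by
    intro t
    refine sup_le (sup_le ?_ (iSup₂_le fun s _ => ?_)) (iSup₂_le fun s _ => ?_)
    · exact (measurable_fst.comp measurable_snd).comap_le
    · exact ((measurable_pi_apply s).comp (measurable_snd.comp measurable_snd)).comap_le
    · exact (ν.measurable_obs s).comap_le

/-- The number `N_k(T)` of draws from arm `k` up to a random, possibly infinite, time `T`. -/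
def countAt (ν : SamplingRule K E) (T : Dataset K E → ℕ∞) (k : Fin K) (D : Dataset K E) : ℕ∞ :=
  ⨆ t : ℕ, ⨆ _ : (t : ℕ∞) ≤ T D, (ν.count k t D : ℕ∞)

/-- The sample mean of arm `k` at a random time `T`. If `T = ∞`, it is the limit of the sample
means of arm `k` after `t` rounds as `t → ∞`. -/
def meanAt (ν : SamplingRule K E) (T : Dataset K E → ℕ∞) (k : Fin K) (D : Dataset K E) : ℝ :=
  if T D = ⊤ then limUnder atTop (fun t : ℕ => ν.mean k t D) else ν.mean k (T D).toNat D

/-- The quantity `𝟙(κ = k) / N_k(T)`, with `1 / ∞ = 0`. -/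
def weight (ν : SamplingRule K E) (T : Dataset K E → ℕ∞) (κ : Dataset K E → Fin K) (k : Fin K)
    (D : Dataset K E) : ℝ≥0∞ :=
  if κ D = k then (ν.countAt T k D : ℝ≥0∞)⁻¹ else 0

end SamplingRule

section Monotone

variable {K : ℕ} {E : Type*} [MeasurableSpace E] {α : Type*} [Preorder α]

/-- `f` is almost surely an increasing function of the table entry `(i, k)` with all other entries
of the data kept fixed: raising that entry from its value in `D` to `x` does not lower `f`, for
almost every dataset `D` and almost every `x` with respect to the law of the entry. -/
def IncreasingInEntry (P : Fin K → Measure ℝ) [∀ k, IsProbabilityMeasure (P k)] (Q : Measure E)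
    (f : Dataset K E → α) (i : ℕ) (k : Fin K) : Prop :=
  ∀ᵐ D ∂(Dataset.law P Q), ∀ᵐ x ∂(P k), D.1 (i, k) ≤ x → f D ≤ f (D.setEntry i k x)

/-- `f` is almost surely a decreasing function of the table entry `(i, k)` with all other entries
of the data kept fixed. -/
def DecreasingInEntry (P : Fin K → Measure ℝ) [∀ k, IsProbabilityMeasure (P k)] (Q : Measure E)
    (f : Dataset K E → α) (i : ℕ) (k : Fin K) : Prop :=
  ∀ᵐ D ∂(Dataset.law P Q), ∀ᵐ x ∂(P k), D.1 (i, k) ≤ x → f (D.setEntry i k x) ≤ f D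

/-- `f` is nonadaptive: almost surely it is a function of the external randomness and of the
seeds alone, so that it does not depend on the entries of the table. -/
def Nonadaptive {β : Type*} (P : Fin K → Measure ℝ) [∀ k, IsProbabilityMeasure (P k)]
    (Q : Measure E) (f : Dataset K E → β) : Prop :=
  ∃ g : E × (ℕ → unitInterval) → β, ∀ᵐ D ∂(Dataset.law P Q), f D = g D.2

end Monotone

section Strategy

variable {K : ℕ} [NeZero K] {E : Type*} [MeasurableSpace E]
  (P : Fin K → Measure ℝ) [∀ k, IsProbabilityMeasure (P k)] (Q : Measure E)
  (ν : SamplingRule K E) (T : Dataset K E → ℕ∞) (κ : Dataset K E → Fin K)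

/-- The data collecting strategy is monotonically increasing. -/
def MonotonicallyIncreasing : Prop :=
  ∀ (i : ℕ) (k : Fin K), IncreasingInEntry P Q (ν.weight T κ k) i k

/-- The data collecting strategy is monotonically decreasing. -/
def MonotonicallyDecreasing : Prop :=
  ∀ (i : ℕ) (k : Fin K), DecreasingInEntry P Q (ν.weight T κ k) i k

/-- The sampling rule is optimistic. -/
def OptimisticSampling : Prop :=
  ∀ (i t : ℕ) (k : Fin K), IncreasingInEntry P Q (ν.count k t) i k

/-- The stopping rule is optimistic. -/
def OptimisticStopping : Prop :=
  ∀ (i : ℕ) (k : Fin K), DecreasingInEntry P Q T i k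

/-- The choosing rule is optimistic. -/
def OptimisticChoosing : Prop :=
  ∀ (i : ℕ) (k : Fin K), IncreasingInEntry P Q (fun D => if κ D = k then (1 : ℕ) else 0) i k

/-- The sampling rule is nonadaptive. -/
def NonadaptiveSampling : Prop := ∀ t : ℕ, Nonadaptive P Q (ν.arm t)

/-- The mean `μ_k` of arm `k`. -/
def armMean (k : Fin K) : ℝ := ∫ y, y ∂(P k)

end Strategy

end

end Bandit

/-! On `κ = k` with `1 ≤ N_k(T) < ∞`, the error of the sample mean is `∑ i, (X*_{i,k} - μ_k) w_i`
with `w_i = 𝟙(κ = k, i < N_k(T)) / N_k(T)`. Whether the entry `(i, k)` is used by time `T` cannot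
depend on its own value: until it is read, the history and hence the stopping decision do not see it
(`countAt_setEntry_le_iff`). So `w_i` inherits in this entry the monotonicity of `𝟙(κ = k) /
N_k(T)`. With all other data fixed, Chebyshev's association inequality gives the covariance of
`X*_{i,k}` and `w_i` the matching sign (`mul_integral_entry_mul_nonneg`).

It remains to exchange the sum over `i` with the expectation, without any bound on `𝔼 N_k(T)`. The
partial sums of the series are averages `(1 / n) ∑_{i < min m n} (X*_{i,k} - μ_k)` with `n =
N_k(T)`, so they are bounded by the supremum over `n` of the absolute centred averages. Finite
second moments make this supremum integrable (`exists_integrable_abs_sum_le`), and dominated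
convergence applies (`integrable_errorAt`). If `N_k(T) = ∞`, all weights vanish, and so does the
error, by the strong law of large numbers.

The optimistic strategies reduce to the monotone ones by comparing `N_k(T)` and `κ` before and after
an entry is raised. -/

namespace Bandit

/-! ### Resampling, a maximal inequality for averages, and the association inequality. -/

section Probability

/-- Resampling one coordinate of a product measure preserves the product measure. -/
lemma measurePreserving_update {ι α : Type*} [DecidableEq ι] [MeasurableSpace α]
    (P : ι → Measure α) [∀ i, IsProbabilityMeasure (P i)] (j : ι) :
    MeasurePreserving (fun q : (ι → α) × α => Function.update q.1 j q.2)
      ((Measure.infinitePi P).prod (P j)) (Measure.infinitePi P) := by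
  have hmeas : Measurable fun q : (ι → α) × α => Function.update q.1 j q.2 := by
    refine measurable_pi_lambda _ fun i => ?_
    by_cases h : i = j
    · subst h
      simpa using measurable_snd
    · simp only [Function.update_of_ne h]
      exact (measurable_pi_apply i).comp measurable_fst
  refine ⟨hmeas, Measure.eq_infinitePi _ fun s t ht => ?_⟩
  have hpi : MeasurableSet (Set.pi (s : Set ι) t) :=
    MeasurableSet.pi s.countable_toSet fun i _ => ht i
  rw [Measure.map_apply hmeas hpi]
  -- The constraint on coordinate `j` moves to the fresh draw, and the old coordinate `j` becomes
  -- free.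
  have hpre : (fun q : (ι → α) × α => Function.update q.1 j q.2) ⁻¹' Set.pi (s : Set ι) t =
      Set.pi ((s.erase j : Finset ι) : Set ι) t ×ˢ (if j ∈ s then t j else Set.univ) := by
    ext ⟨X, x⟩
    simp only [Set.mem_preimage, Set.mem_pi, Set.mem_prod, Finset.mem_coe, Finset.mem_erase]
    constructor
    · intro h
      refine ⟨fun i hi => by simpa [Function.update_of_ne hi.1] using h i hi.2, ?_⟩
      split_ifs with hj
      · simpa using h j hj
      · trivial
    · rintro ⟨h1, h2⟩ i hi
      by_cases hij : i = j
      · subst hij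
        simpa [hi] using h2
      · simpa [Function.update_of_ne hij] using h1 i ⟨hij, hi⟩
  rw [hpre, Measure.prod_prod, Measure.infinitePi_pi P fun i _ => ht i]
  split_ifs with hj
  · rw [mul_comm, Finset.mul_prod_erase s (fun i => P i (t i)) hj]
  · rw [measure_univ, mul_one, Finset.erase_eq_of_notMem hj]

/-- An integrable random variable that is dominated by an almost everywhere summable series. -/
lemma exists_integrable_ge_of_summable {Ω : Type*} [MeasurableSpace Ω] {μ : Measure Ω}
    {F : ℕ → Ω → ℝ} (hF : ∀ j, Integrable (F j) μ) (hF0 : ∀ j ω, 0 ≤ F j ω)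
    (hs : Summable fun j => ∫ ω, F j ω ∂μ) :
    ∃ H : Ω → ℝ, Integrable H μ ∧ ∀ᵐ ω ∂μ, ∀ j, F j ω ≤ H ω := by
  have hmeas : ∀ j, AEMeasurable (fun ω => ENNReal.ofReal (F j ω)) μ :=
    fun j => (hF j).aemeasurable.ennreal_ofReal
  have hfin : ∫⁻ ω, ∑' j, ENNReal.ofReal (F j ω) ∂μ ≠ ∞ := by
    rw [lintegral_tsum hmeas]
    have : ∀ j, ∫⁻ ω, ENNReal.ofReal (F j ω) ∂μ = ENNReal.ofReal (∫ ω, F j ω ∂μ) := fun j =>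
      (ofReal_integral_eq_lintegral_ofReal (hF j) (ae_of_all _ (hF0 j))).symm
    simp_rw [this]
    rw [← ENNReal.ofReal_tsum_of_nonneg (fun j => integral_nonneg (hF0 j)) hs]
    exact ENNReal.ofReal_ne_top
  refine ⟨fun ω => (∑' j, ENNReal.ofReal (F j ω)).toReal,
    integrable_toReal_of_lintegral_ne_top (AEMeasurable.tsum hmeas) hfin, ?_⟩
  filter_upwards [ae_lt_top' (AEMeasurable.tsum hmeas) hfin] with ω hω j
  rw [← ENNReal.ofReal_le_iff_le_toReal hω.ne]
  exact ENNReal.le_tsum j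

/-- A maximal inequality for the averages of centred, pairwise independent, square integrable
random variables with bounded variances: their supremum is dominated by an integrable variable. -/
lemma exists_integrable_abs_sum_le {Ω : Type*} [MeasurableSpace Ω] {μ : Measure Ω}
    [IsProbabilityMeasure μ] {Y : ℕ → Ω → ℝ} (hY : ∀ i, MemLp (Y i) 2 μ)
    (hindep : Pairwise fun i j => IndepFun (Y i) (Y j) μ) (hmean : ∀ i, ∫ ω, Y i ω ∂μ = 0)
    {v : ℝ} (hv : ∀ i, ∫ ω, Y i ω ^ 2 ∂μ ≤ v) :
    ∃ G : Ω → ℝ, Integrable G μ ∧ ∀ᵐ ω ∂μ, ∀ n : ℕ,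
      |∑ i ∈ Finset.range n, Y i ω| ≤ n * G ω := by
  have hv0 : 0 ≤ v := (integral_nonneg fun ω => sq_nonneg (Y 0 ω)).trans (hv 0)
  have hsq : ∀ s : Finset ℕ, ∫ ω, (∑ i ∈ s, Y i ω) ^ 2 ∂μ ≤ s.card * v := by
    intro s
    have hvar := IndepFun.variance_sum (s := s) (fun i _ => hY i)
      (fun i _ j _ hij => hindep hij)
    have hLp : MemLp (∑ i ∈ s, Y i) 2 μ := memLp_finsetSum' s fun i _ => hY i
    rw [variance_of_integral_eq_zero hLp.aemeasurable] at hvar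
    · simp only [Finset.sum_apply] at hvar
      rw [hvar, ← nsmul_eq_mul]
      refine Finset.sum_le_card_nsmul _ _ _ fun i _ => ?_
      rw [variance_of_integral_eq_zero (hY i).aemeasurable (hmean i)]
      exact hv i
    · simp only [Finset.sum_apply]
      rw [integral_finsetSum _ fun i _ => (hY i).integrable one_le_two]
      simp [hmean]
  have habs : ∀ s : Finset ℕ, ∫ ω, (∑ i ∈ s, |Y i ω|) ^ 2 ∂μ ≤ s.card ^ 2 * v := by
    intro s
    calc ∫ ω, (∑ i ∈ s, |Y i ω|) ^ 2 ∂μ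
        ≤ ∫ ω, s.card * ∑ i ∈ s, Y i ω ^ 2 ∂μ := by
          refine integral_mono (MemLp.integrable_sq (memLp_finsetSum s fun i _ => (hY i).abs))
            ((integrable_finsetSum _ fun i _ => (hY i).integrable_sq).const_mul _) fun ω => ?_
          simpa using sq_sum_le_card_mul_sum_sq (s := s) (f := fun i => |Y i ω|)
      _ = s.card * ∑ i ∈ s, ∫ ω, Y i ω ^ 2 ∂μ := by
          rw [integral_const_mul, integral_finsetSum _ fun i _ => (hY i).integrable_sq]
      _ ≤ s.card * (s.card * v) := by
          gcongr
          rw [← nsmul_eq_mul]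
          exact Finset.sum_le_card_nsmul _ _ _ fun i _ => hv i
      _ = s.card ^ 2 * v := by ring
  -- Averages are controlled along the squares `(j + 1) ^ 2`; `B j` bounds the fluctuation up to the
  -- next square.
  let S : ℕ → Ω → ℝ := fun j ω => ∑ i ∈ Finset.range ((j + 1) ^ 2), Y i ω
  let B : ℕ → Ω → ℝ := fun j ω => ∑ i ∈ Finset.Ico ((j + 1) ^ 2) ((j + 2) ^ 2), |Y i ω|
  have hSint : ∀ j, Integrable (fun ω => S j ω ^ 2) μ := fun j =>
    MemLp.integrable_sq (memLp_finsetSum _ fun i _ => hY i)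
  have hBint : ∀ j, Integrable (fun ω => B j ω ^ 2) μ := fun j =>
    MemLp.integrable_sq (memLp_finsetSum _ fun i _ => (hY i).abs)
  -- The denominator is the square of the block start `(j + 1) ^ 2`. Since `𝔼 S² ≤ (j + 1)² v` and
  -- `𝔼 B² ≤ (2j + 3)² v ≤ 9 (j + 1)² v`, the expectations are at most `10 v / (j + 1)²`, which is
  -- summable.
  let F : ℕ → Ω → ℝ := fun j ω => (S j ω ^ 2 + B j ω ^ 2) / ((j : ℝ) + 1) ^ 4
  have hFint : ∀ j, Integrable (F j) μ := fun j => ((hSint j).add (hBint j)).div_const _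
  have hF0 : ∀ j ω, 0 ≤ F j ω := fun j ω => by positivity
  have hFle : ∀ j, ∫ ω, F j ω ∂μ ≤ 10 * v * (1 / (((j + 1 : ℕ) : ℝ) ^ 2)) := by
    intro j
    have h1 := hsq (Finset.range ((j + 1) ^ 2))
    have h2 := habs (Finset.Ico ((j + 1) ^ 2) ((j + 2) ^ 2))
    have hc : (j + 2) ^ 2 - (j + 1) ^ 2 = 2 * j + 3 := by
      rw [Nat.sub_eq_iff_eq_add (by gcongr; omega)]
      ring
    rw [Finset.card_range] at h1
    rw [Nat.card_Ico, hc] at h2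
    push_cast at h1 h2 ⊢
    have hj : (0 : ℝ) ≤ j := j.cast_nonneg
    simp only [F]
    rw [integral_div, integral_add (hSint j) (hBint j), div_le_iff₀ (by positivity)]
    have h3 : 10 * v * (1 / ((j : ℝ) + 1) ^ 2) * ((j : ℝ) + 1) ^ 4 = 10 * v * (j + 1) ^ 2 := by
      field_simp
    rw [h3]
    have h4 : (2 * (j : ℝ) + 3) ^ 2 * v ≤ 9 * (j + 1) ^ 2 * v := by
      gcongr
      nlinarith
    calc _ ≤ ((j : ℝ) + 1) ^ 2 * v + (2 * (j : ℝ) + 3) ^ 2 * v := add_le_add h1 h2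
      _ ≤ _ := by linarith
  have hsum : Summable fun j => ∫ ω, F j ω ∂μ := by
    refine Summable.of_nonneg_of_le (fun j => integral_nonneg (hF0 j)) hFle ?_
    refine Summable.mul_left _ ?_
    exact (summable_nat_add_iff 1).2 (Real.summable_one_div_nat_pow.2 one_lt_two)
  obtain ⟨H, hH, hHle⟩ := exists_integrable_ge_of_summable hFint hF0 hsum
  refine ⟨fun ω => 2 + H ω, (integrable_const _).add hH, ?_⟩
  filter_upwards [hHle] with ω hω n
  rcases Nat.eq_zero_or_pos n with rfl | hn
  · simp
  obtain ⟨j, hj⟩ : ∃ j, n.sqrt = j + 1 := ⟨n.sqrt - 1, by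
    have := Nat.sqrt_pos.2 hn
    omega⟩
  have hle : (j + 1) ^ 2 ≤ n := by
    rw [← hj]
    exact Nat.sqrt_le' n
  have hlt : n < (j + 2) ^ 2 := by
    have := Nat.lt_succ_sqrt' n
    rwa [hj] at this
  have hsplit : |∑ i ∈ Finset.range n, Y i ω| ≤ |S j ω| + B j ω := by
    rw [← Finset.sum_range_add_sum_Ico _ hle]
    refine (abs_add_le _ _).trans (add_le_add le_rfl ?_)
    refine (Finset.abs_sum_le_sum_abs _ _).trans ?_
    refine Finset.sum_le_sum_of_subset_of_nonneg ?_ fun i _ _ => abs_nonneg _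
    exact Finset.Ico_subset_Ico_right hlt.le
  have hq : (0 : ℝ) < ((j : ℝ) + 1) ^ 2 := by positivity
  have hqn : ((j : ℝ) + 1) ^ 2 ≤ n := by exact_mod_cast hle
  have hkey : |S j ω| + B j ω ≤ ((j : ℝ) + 1) ^ 2 * (2 + F j ω) := by
    have hFq : ((j : ℝ) + 1) ^ 2 * F j ω = (|S j ω| ^ 2 + B j ω ^ 2) / ((j : ℝ) + 1) ^ 2 := by
      simp only [F, sq_abs]
      field_simp
    -- With `q = (j + 1)²` this is `a ≤ q + a² / q`. Used for `|S j ω|` and for `B j ω`, it produces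
    -- the constant `2`.
    have aux : ∀ a : ℝ, a ≤ ((j : ℝ) + 1) ^ 2 + a ^ 2 / ((j : ℝ) + 1) ^ 2 := by
      intro a
      have h := sq_nonneg (a - ((j : ℝ) + 1) ^ 2)
      rw [← sub_nonneg]
      have : ((j : ℝ) + 1) ^ 2 + a ^ 2 / ((j : ℝ) + 1) ^ 2 - a =
          ((a - ((j : ℝ) + 1) ^ 2) ^ 2 + a ^ 2 + (((j : ℝ) + 1) ^ 2) ^ 2) /
            (2 * ((j : ℝ) + 1) ^ 2) := by
        field_simp
        ring
      rw [this]
      positivity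
    rw [mul_add, hFq, add_div]
    linarith [aux |S j ω|, aux (B j ω)]
  calc _ ≤ ((j : ℝ) + 1) ^ 2 * (2 + F j ω) := hsplit.trans hkey
    _ ≤ n * (2 + H ω) := by
      have := hF0 j ω
      have := hω j
      gcongr

/-- A form of Chebyshev's association inequality. -/
lemma integral_sub_mul_nonneg {μ : Measure ℝ} [IsProbabilityMeasure μ]
    (hμ : Integrable (fun y : ℝ => y) μ) {h : ℝ → ℝ} (hm : Measurable h) {C : ℝ}
    (hC : ∀ x, |h x| ≤ C) (hmono : ∀ᵐ x ∂μ, ∀ᵐ y ∂μ, x ≤ y → h x ≤ h y) :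
    0 ≤ ∫ x, (x - ∫ y, y ∂μ) * h x ∂μ := by
  have hint : Integrable h μ :=
    Integrable.of_bound hm.aestronglyMeasurable C (ae_of_all _ hC)
  have hxh : Integrable (fun x => x * h x) μ :=
    hμ.mul_bdd (c := C) hm.aestronglyMeasurable (ae_of_all _ hC)
  have hset : MeasurableSet {q : ℝ × ℝ | q.1 ≤ q.2 → h q.1 ≤ h q.2} := by
    have : {q : ℝ × ℝ | q.1 ≤ q.2 → h q.1 ≤ h q.2} =
        {q : ℝ × ℝ | q.1 ≤ q.2}ᶜ ∪ {q : ℝ × ℝ | h q.1 ≤ h q.2} := by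
      ext q
      simp [imp_iff_not_or]
    rw [this]
    exact (measurableSet_le measurable_fst measurable_snd).compl.union
      (measurableSet_le (hm.comp measurable_fst) (hm.comp measurable_snd))
  have hp : ∀ᵐ q ∂(μ.prod μ), q.1 ≤ q.2 → h q.1 ≤ h q.2 :=
    (Measure.ae_prod_iff_ae_ae hset).2 hmono
  have hp' : ∀ᵐ q ∂(μ.prod μ), q.2 ≤ q.1 → h q.2 ≤ h q.1 :=
    Measure.measurePreserving_swap.quasiMeasurePreserving.ae hp
  -- For independent copies `x`, `y`, the expectation of `(x - y) (h x - h y)` is twice the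
  -- covariance of `x` and `h x`.
  have hnn : 0 ≤ ∫ q, (q.1 - q.2) * (h q.1 - h q.2) ∂(μ.prod μ) := by
    refine integral_nonneg_of_ae ?_
    filter_upwards [hp, hp'] with q h1 h2
    rcases le_total q.1 q.2 with hq | hq
    · exact mul_nonneg_of_nonpos_of_nonpos (sub_nonpos.2 hq) (sub_nonpos.2 (h1 hq))
    · exact mul_nonneg (sub_nonneg.2 hq) (sub_nonneg.2 (h2 hq))
  have e1 : Integrable (fun q : ℝ × ℝ => q.1 * h q.1) (μ.prod μ) := hxh.comp_fst μ
  have e2 : Integrable (fun q : ℝ × ℝ => q.2 * h q.2) (μ.prod μ) := hxh.comp_snd μ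
  have e3 : Integrable (fun q : ℝ × ℝ => q.1 * h q.2) (μ.prod μ) := hμ.mul_prod hint
  have e4 : Integrable (fun q : ℝ × ℝ => h q.1 * q.2) (μ.prod μ) := hint.mul_prod hμ
  have hexp : ∫ q, (q.1 - q.2) * (h q.1 - h q.2) ∂(μ.prod μ) =
      2 * (∫ x, x * h x ∂μ - (∫ y, y ∂μ) * ∫ x, h x ∂μ) := by
    have : (fun q : ℝ × ℝ => (q.1 - q.2) * (h q.1 - h q.2)) =
        fun q => (q.1 * h q.1 + q.2 * h q.2) - (q.1 * h q.2 + h q.1 * q.2) := by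
      ext q
      ring
    have hsub : ∫ q : ℝ × ℝ, (q.1 * h q.1 + q.2 * h q.2) - (q.1 * h q.2 + h q.1 * q.2)
        ∂(μ.prod μ) = ∫ q : ℝ × ℝ, q.1 * h q.1 + q.2 * h q.2 ∂(μ.prod μ) -
          ∫ q : ℝ × ℝ, q.1 * h q.2 + h q.1 * q.2 ∂(μ.prod μ) :=
      integral_sub (e1.add e2) (e3.add e4)
    rw [this, hsub, integral_add e1 e2, integral_add e3 e4,
      integral_prod_mul (fun x : ℝ => x) h, integral_prod_mul h (fun x : ℝ => x),
      integral_fun_fst (fun x => x * h x), integral_fun_snd (fun x => x * h x)]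
    simp only [probReal_univ, one_smul]
    ring
  have hgoal : ∫ x, (x - ∫ y, y ∂μ) * h x ∂μ =
      ∫ x, x * h x ∂μ - (∫ y, y ∂μ) * ∫ x, h x ∂μ := by
    rw [← integral_const_mul, ← integral_sub hxh (hint.const_mul _)]
    congr 1
    ext x
    ring
  rw [hgoal]
  linarith [hexp ▸ hnn]

end Probability

/-! ### How the history depends on the table. -/

namespace SamplingRule

variable {K : ℕ} [NeZero K] {E : Type*} [MeasurableSpace E] (ν : SamplingRule K E)

lemma history_succ_castSucc (D : Dataset K E) (t : ℕ) (s : Fin t) :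
    ν.history D (t + 1) s.castSucc = ν.history D t s := by
  simp only [history, Fin.snoc_castSucc]

lemma history_apply (D : Dataset K E) (t : ℕ) (s : Fin t) :
    ν.history D t s = (ν.arm s D, ν.obs s D) := by
  induction t with
  | zero => exact s.elim0
  | succ t ih =>
    induction s using Fin.lastCases with
    | last => rfl
    | cast s => rw [history_succ_castSucc, ih]; rfl

lemma card_filter_history (D : Dataset K E) (t : ℕ) (a : Fin K) :
    (Finset.univ.filter fun s : Fin t => (ν.history D t s).1 = a).card = ν.count a t D := by
  simp only [Finset.card_filter, history_apply, count]
  exact Fin.sum_univ_eq_sum_range (fun s => if ν.arm s D = a then 1 else 0) t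

lemma arm_eq_pick (t : ℕ) (D : Dataset K E) :
    ν.arm t D = pick (ν.prob t D.2.1 (ν.history D t)) (D.2.2 t) := by
  simp only [arm, history, Fin.snoc_last]

lemma obs_eq (t : ℕ) (D : Dataset K E) :
    ν.obs t D = D.1 (ν.count (ν.arm t D) t D, ν.arm t D) := by
  rw [← card_filter_history, arm_eq_pick]
  simp only [obs, history, Fin.snoc_last]

lemma count_succ (k : Fin K) (t : ℕ) (D : Dataset K E) :
    ν.count k (t + 1) D = ν.count k t D + if ν.arm t D = k then 1 else 0 :=
  Finset.sum_range_succ _ _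

lemma count_mono (k : Fin K) (D : Dataset K E) : Monotone fun t => ν.count k t D :=
  monotone_nat_of_le_succ fun t => by
    rw [count_succ]
    exact Nat.le_add_right _ _

/-- The pulls of an arm read its column in order, so the sample mean depends on the strategy only
through the number of draws. -/
lemma sum_eq (k : Fin K) (t : ℕ) (D : Dataset K E) :
    ν.sum k t D = ∑ i ∈ Finset.range (ν.count k t D), D.1 (i, k) := by
  induction t with
  | zero => simp [sum, count]
  | succ t ih =>
    rw [sum, Finset.sum_range_succ, ← sum, ih, count_succ]
    split_ifs with h
    · rw [Finset.sum_range_succ, obs_eq, h]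
    · simp

lemma measurable_arm (t : ℕ) : Measurable (ν.arm t) :=
  measurable_fst.comp ((measurable_pi_apply _).comp (ν.measurable_history (t + 1)))

lemma measurable_count (k : Fin K) (t : ℕ) : Measurable (ν.count k t) :=
  Finset.measurable_sum _ fun s _ =>
    Measurable.ite (ν.measurable_arm s (measurableSet_singleton k)) measurable_const
      measurable_const

/-- The data of the first `t` rounds do not depend on an entry that has not been used yet. -/
lemma history_eq_of_count_le {D D' : Dataset K E} {i : ℕ} {k : Fin K} (h2 : D'.2 = D.2)
    (h1 : ∀ j, j ≠ (i, k) → D'.1 j = D.1 j) {t : ℕ} (hc : ν.count k t D ≤ i) :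
    ν.history D' t = ν.history D t := by
  induction t with
  | zero => rfl
  | succ t ih =>
    have ih := ih ((ν.count_mono k D t.le_succ).trans hc)
    have harm : ν.arm t D' = ν.arm t D := by rw [arm_eq_pick, arm_eq_pick, ih, h2]
    have hcount : ∀ a, ν.count a t D' = ν.count a t D := fun a => by
      rw [← card_filter_history, ← card_filter_history, ih]
    have hobs : ν.obs t D' = ν.obs t D := by
      rw [obs_eq, obs_eq, harm, hcount]
      -- Reading `(i, k)` in this round would raise the count of arm `k` to `i + 1`, against `hc`.
      refine h1 _ fun h => ?_
      obtain ⟨ha, hb⟩ := Prod.ext_iff.1 h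
      simp only at ha hb
      rw [count_succ, if_pos hb, ← hb, ha] at hc
      omega
    funext s
    induction s using Fin.lastCases with
    | last =>
      rw [history_apply, history_apply]
      exact Prod.ext harm hobs
    | cast s => rw [history_succ_castSucc, history_succ_castSucc, ih]

/-- Events of `ℱ_t` are determined by `W₋₁`, the seeds and the history up to `t`. Here all seeds,
future ones included, are kept equal, so it does no harm to pass to the larger σ-algebra generated
by `Φ`. -/
lemma mem_iff_of_history_eq {D D' : Dataset K E} (h2 : D'.2 = D.2) {t : ℕ}
    (h : ν.history D' t = ν.history D t) {A : Set (Dataset K E)}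
    (hA : MeasurableSet[ν.filtration t] A) : D' ∈ A ↔ D ∈ A := by
  let Φ : Dataset K E → (E × (ℕ → unitInterval)) × (Fin t → Fin K × ℝ) :=
    fun D => (D.2, ν.history D t)
  have hle : ν.filtration t ≤ MeasurableSpace.comap Φ inferInstance := by
    have hΦ : Measurable[MeasurableSpace.comap Φ inferInstance] Φ := comap_measurable Φ
    refine sup_le (sup_le ?_ (iSup₂_le fun s _ => ?_)) (iSup₂_le fun s hs => ?_)
    · exact (Measurable.comp (measurable_fst.comp measurable_fst) hΦ).comap_le
    · exact (Measurable.comp ((measurable_pi_apply s).comp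
        (measurable_snd.comp measurable_fst)) hΦ).comap_le
    · have : ν.obs s = fun D => ((Φ D).2 ⟨s, hs⟩).2 := by
        funext D
        simp only [Φ, history_apply]
      rw [this]
      exact (Measurable.comp (measurable_snd.comp ((measurable_pi_apply _).comp
        measurable_snd)) hΦ).comap_le
  obtain ⟨B, -, rfl⟩ := hle A hA
  have hΦ : Φ D' = Φ D := Prod.ext h2 h
  simp only [Set.mem_preimage, hΦ]

/-! ### Counts and sample means at a stopping time. -/

section StoppingTime

variable {T : Dataset K E → ℕ∞}

lemma count_le_countAt {t : ℕ} {D : Dataset K E} (h : (t : ℕ∞) ≤ T D) (k : Fin K) :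
    (ν.count k t D : ℕ∞) ≤ ν.countAt T k D :=
  le_iSup₂_of_le (f := fun (t : ℕ) (_ : (t : ℕ∞) ≤ T D) => (ν.count k t D : ℕ∞)) t h le_rfl

lemma countAt_le_iff {k : Fin K} {D : Dataset K E} {n : ℕ∞} :
    ν.countAt T k D ≤ n ↔ ∀ t : ℕ, (t : ℕ∞) ≤ T D → (ν.count k t D : ℕ∞) ≤ n :=
  iSup₂_le_iff

lemma countAt_of_eq_natCast {t : ℕ} {D : Dataset K E} (h : T D = t) (k : Fin K) :
    ν.countAt T k D = ν.count k t D := by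
  refine le_antisymm (ν.countAt_le_iff.2 fun s hs => ?_) (ν.count_le_countAt h.ge k)
  rw [h, Nat.cast_le] at hs
  exact_mod_cast ν.count_mono k D hs

lemma countAt_mono {S T : Dataset K E → ℕ∞} {k : Fin K} {D D' : Dataset K E}
    (hST : S D ≤ T D') (hc : ∀ t, ν.count k t D ≤ ν.count k t D') :
    ν.countAt S k D ≤ ν.countAt T k D' :=
  ν.countAt_le_iff.2 fun t ht =>
    le_trans (by exact_mod_cast hc t) (ν.count_le_countAt (ht.trans hST) k)

/-- If the entry `(i, k)` is not used before `T` stops on `D`, both datasets have the same history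
until then. As `{T ≤ t}` is in `ℱ_t`, the strategy also stops by that time on `D'`, still without
using the entry. By symmetry, using an entry does not depend on its value. -/
lemma countAt_le_of_countAt_le (hT : IsStoppingTime ν.filtration T)
    {D D' : Dataset K E} {i : ℕ} {k : Fin K} (h2 : D'.2 = D.2)
    (h1 : ∀ j, j ≠ (i, k) → D'.1 j = D.1 j) (h : ν.countAt T k D ≤ i) :
    ν.countAt T k D' ≤ i := by
  have key : ∀ t : ℕ, (t : ℕ∞) ≤ T D → ν.history D' t = ν.history D t := fun t ht =>
    ν.history_eq_of_count_le h2 h1 (by exact_mod_cast (ν.count_le_countAt ht k).trans h)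
  have hcount : ∀ t : ℕ, (t : ℕ∞) ≤ T D → ν.count k t D' = ν.count k t D := fun t ht => by
    rw [← card_filter_history, ← card_filter_history, key t ht]
  have hle : T D' ≤ T D := by
    rcases eq_or_ne (T D) ⊤ with htop | htop
    · rw [htop]
      exact le_top
    · obtain ⟨t, ht⟩ := ENat.ne_top_iff_exists.1 htop
      have := (ν.mem_iff_of_history_eq h2 (key t ht.le) (hT t)).2 ht.ge
      rw [← ht]
      exact this
  refine ν.countAt_le_iff.2 fun t ht => ?_
  rw [hcount t (ht.trans hle)]
  exact (ν.count_le_countAt (ht.trans hle) k).trans h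

lemma measurable_of_isStoppingTime (hT : IsStoppingTime ν.filtration T) : Measurable T :=
  ENat.measurable_iff.2 fun n => (ν.filtration.le n) _ (hT.measurableSet_eq n)

lemma measurable_countAt (hT : Measurable T) (k : Fin K) : Measurable (ν.countAt T k) := by
  have : BorelSpace ℕ∞ := ⟨borel_eq_top_of_countable.symm⟩
  refine Measurable.iSup fun t => ?_
  have : (fun D => ⨆ _ : (t : ℕ∞) ≤ T D, (ν.count k t D : ℕ∞)) =
      fun D => if (t : ℕ∞) ≤ T D then (ν.count k t D : ℕ∞) else 0 := by
    funext D
    split_ifs with h <;> simp [h]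
  rw [this]
  refine Measurable.ite (measurableSet_le measurable_const hT) ?_ measurable_const
  exact measurable_from_top.comp (ν.measurable_count k t)

lemma measurable_weight (hT : Measurable T) {κ : Dataset K E → Fin K} (hκ : Measurable κ)
    (k : Fin K) : Measurable (ν.weight T κ k) := by
  refine Measurable.ite (hκ (measurableSet_singleton k)) ?_ measurable_const
  exact (measurable_from_top (f := fun n : ℕ∞ => (n : ℝ≥0∞)⁻¹)).comp
    (ν.measurable_countAt hT k)

/-- If arm `k` is drawn a finite number of times up to time `T`, then its sample mean at time `T`
is the average of the used entries. -/
lemma meanAt_of_countAt_eq_natCast {k : Fin K} {D : Dataset K E} {n : ℕ}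
    (h : ν.countAt T k D = n) :
    ν.meanAt T k D = (∑ i ∈ Finset.range n, D.1 (i, k)) / n := by
  by_cases htop : T D = ⊤
  · rw [meanAt, if_pos htop]
    refine Tendsto.limUnder_eq ?_
    have hle : ∀ t, ν.count k t D ≤ n := fun t => by
      exact_mod_cast h ▸ ν.count_le_countAt (T := T) (htop ▸ le_top) k
    obtain ⟨t₀, ht₀⟩ : ∃ t₀, n ≤ ν.count k t₀ D := by
      rcases Nat.eq_zero_or_pos n with rfl | hn
      · exact ⟨0, Nat.zero_le _⟩
      -- A supremum of naturals equal to `n > 0` is attained, as otherwise `n - 1` would be an upper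
      -- bound.
      by_contra! hlt
      have : ν.countAt T k D ≤ (n - 1 : ℕ) := ν.countAt_le_iff.2 fun t _ => by
        have := hlt t
        exact_mod_cast (by omega : ν.count k t D ≤ n - 1)
      rw [h, Nat.cast_le] at this
      omega
    refine tendsto_const_nhds.congr' ?_
    filter_upwards [eventually_ge_atTop t₀] with t ht
    have : ν.count k t D = n := le_antisymm (hle t) (ht₀.trans (ν.count_mono k D ht))
    rw [mean, sum_eq, this]
  · obtain ⟨t, ht⟩ := ENat.ne_top_iff_exists.1 htop
    have hc : ν.count k t D = n := by
      rw [ν.countAt_of_eq_natCast ht.symm] at h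
      exact_mod_cast h
    rw [meanAt, if_neg htop, ← ht, ENat.toNat_natCast, mean, sum_eq, hc]

/-- If arm `k` is drawn infinitely often up to time `T`, then its sample mean at time `T` is the
limit of the averages of the entries. -/
lemma meanAt_of_countAt_eq_top {k : Fin K} {D : Dataset K E} (h : ν.countAt T k D = ⊤) {m : ℝ}
    (hlim : Tendsto (fun n : ℕ => (∑ i ∈ Finset.range n, D.1 (i, k)) / n) atTop (𝓝 m)) :
    ν.meanAt T k D = m := by
  have htop : T D = ⊤ := by
    by_contra htop
    obtain ⟨t, ht⟩ := ENat.ne_top_iff_exists.1 htop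
    rw [ν.countAt_of_eq_natCast ht.symm] at h
    exact ENat.natCast_ne_top _ h
  rw [meanAt, if_pos htop]
  refine Tendsto.limUnder_eq ?_
  -- The sample means over time are the column averages evaluated along the counts, so divergence of
  -- the counts suffices.
  have hc : Tendsto (fun t => ν.count k t D) atTop atTop := by
    refine tendsto_atTop_atTop_of_monotone (ν.count_mono k D) fun n => ?_
    by_contra! hlt
    have : ν.countAt T k D ≤ n := ν.countAt_le_iff.2 fun t _ => by exact_mod_cast (hlt t).le
    rw [h] at this
    exact ENat.natCast_ne_top n (top_le_iff.1 this)
  refine (hlim.comp hc).congr fun t => ?_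
  rw [Function.comp, mean, sum_eq]

end StoppingTime

end SamplingRule

/-! ### The law of the data under replacement of an entry. -/

section Data

variable {K : ℕ} {E : Type*} [MeasurableSpace E]
  (P : Fin K → Measure ℝ) [∀ k, IsProbabilityMeasure (P k)] (Q : Measure E)

instance [IsProbabilityMeasure Q] : IsProbabilityMeasure (Dataset.law P Q) := by
  unfold Dataset.law
  infer_instance

variable [IsProbabilityMeasure Q]

lemma measurePreserving_setEntry (i : ℕ) (k : Fin K) :
    MeasurePreserving (fun q : Dataset K E × ℝ => q.1.setEntry i k q.2)
      ((Dataset.law P Q).prod (P k)) (Dataset.law P Q) := by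
  let μ : Measure (ℕ × Fin K → ℝ) := Measure.infinitePi fun p : ℕ × Fin K => P p.2
  let ρ : Measure (E × (ℕ → unitInterval)) :=
    Q.prod (Measure.infinitePi fun _ : ℕ => (volume : Measure unitInterval))
  have h1 : MeasurePreserving MeasurableEquiv.prodAssoc ((μ.prod ρ).prod (P k))
      (μ.prod (ρ.prod (P k))) := measurePreserving_prodAssoc _ _ _
  have h2 : MeasurePreserving (Prod.map id Prod.swap) (μ.prod (ρ.prod (P k)))
      (μ.prod ((P k).prod ρ)) :=
    (MeasurePreserving.id μ).prod Measure.measurePreserving_swap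
  have h3 : MeasurePreserving MeasurableEquiv.prodAssoc.symm (μ.prod ((P k).prod ρ))
      ((μ.prod (P k)).prod ρ) := (measurePreserving_prodAssoc _ _ _).symm _
  have h4 := (measurePreserving_update (fun p : ℕ × Fin K => P p.2) (i, k)).prod
    (MeasurePreserving.id ρ)
  exact h4.comp (h3.comp (h2.comp h1))

/-- An almost sure property survives resampling of an entry because the resampled dataset has the
same law. -/
lemma ae_ae_setEntry {p : Dataset K E → Prop} (h : ∀ᵐ D ∂(Dataset.law P Q), p D) (i : ℕ)
    (k : Fin K) : ∀ᵐ D ∂(Dataset.law P Q), ∀ᵐ x ∂(P k), p (D.setEntry i k x) :=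
  Measure.ae_ae_of_ae_prod ((measurePreserving_setEntry P Q i k).quasiMeasurePreserving.ae h)

lemma measurePreserving_entry (i : ℕ) (k : Fin K) :
    MeasurePreserving (fun X : ℕ × Fin K → ℝ => X (i, k))
      (Measure.infinitePi fun p : ℕ × Fin K => P p.2) (P k) :=
  measurePreserving_eval_infinitePi (fun p : ℕ × Fin K => P p.2) (i, k)

lemma integral_entry (i : ℕ) (k : Fin K) {f : ℝ → ℝ} (hf : Measurable f) :
    ∫ X, f (X (i, k)) ∂(Measure.infinitePi fun p : ℕ × Fin K => P p.2) = ∫ y, f y ∂(P k) := by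
  have h := measurePreserving_entry P i k
  rw [← h.map_eq, integral_map h.aemeasurable hf.aestronglyMeasurable]

lemma indepFun_entry (k : Fin K) {f : ℝ → ℝ} (hf : Measurable f) :
    Pairwise fun i j : ℕ => IndepFun (fun X : ℕ × Fin K → ℝ => f (X (i, k)))
      (fun X : ℕ × Fin K → ℝ => f (X (j, k)))
      (Measure.infinitePi fun p : ℕ × Fin K => P p.2) := fun i j hij =>
  (iIndepFun_infinitePi (P := fun p : ℕ × Fin K => P p.2) (X := fun _ => f)
    fun _ => hf).indepFun (i := (i, k)) (j := (j, k)) (by simpa using hij)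

lemma exists_integrable_abs_sum_entry_le {k : Fin K} (hP : MemLp (fun y : ℝ => y) 2 (P k)) :
    ∃ G : Dataset K E → ℝ, Integrable G (Dataset.law P Q) ∧
      ∀ᵐ D ∂(Dataset.law P Q), ∀ n : ℕ,
        |∑ i ∈ Finset.range n, (D.1 (i, k) - armMean P k)| ≤ n * G D := by
  have hY : MemLp (fun y : ℝ => y - armMean P k) 2 (P k) := hP.sub (memLp_const _)
  have hf : Measurable fun y : ℝ => y - armMean P k := measurable_id.sub_const _
  obtain ⟨G, hG, hle⟩ := exists_integrable_abs_sum_le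
    (μ := Measure.infinitePi fun p : ℕ × Fin K => P p.2)
    (Y := fun i X => X (i, k) - armMean P k)
    (v := ∫ y, (y - armMean P k) ^ 2 ∂(P k))
    (fun i => hY.comp_measurePreserving (measurePreserving_entry P i k))
    (indepFun_entry P k hf)
    (fun i => by
      rw [integral_entry P i k hf, integral_sub (hP.integrable one_le_two) (integrable_const _)]
      simp [armMean])
    (fun i => (integral_entry P i k (hf.pow_const 2)).le)
  have hfst : MeasurePreserving Prod.fst (Dataset.law P Q)
    (Measure.infinitePi fun p : ℕ × Fin K => P p.2) := measurePreserving_fst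
  exact ⟨fun D => G D.1, hfst.integrable_comp_of_integrable hG,
    hfst.quasiMeasurePreserving.ae hle⟩

lemma ae_tendsto_average_entry {k : Fin K} (hP : Integrable (fun y : ℝ => y) (P k)) :
    ∀ᵐ D ∂(Dataset.law P Q), Tendsto
      (fun n : ℕ => (∑ i ∈ Finset.range n, D.1 (i, k)) / (n : ℝ)) atTop (𝓝 (armMean P k)) := by
  have hident : ∀ i, IdentDistrib (fun X : ℕ × Fin K → ℝ => X (i, k)) (fun X => X (0, k))
      (Measure.infinitePi fun p : ℕ × Fin K => P p.2)
      (Measure.infinitePi fun p : ℕ × Fin K => P p.2) := fun i =>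
    ⟨(measurable_pi_apply _).aemeasurable, (measurable_pi_apply _).aemeasurable,
      (measurePreserving_entry P i k).map_eq.trans (measurePreserving_entry P 0 k).map_eq.symm⟩
  have h := strong_law_ae_real (μ := Measure.infinitePi fun p : ℕ × Fin K => P p.2)
    (fun i X => X (i, k))
    ((measurePreserving_entry P 0 k).integrable_comp_of_integrable hP)
    (indepFun_entry P k measurable_id) hident
  have hmean : ∫ X, X (0, k) ∂(Measure.infinitePi fun p : ℕ × Fin K => P p.2) = armMean P k :=
    integral_entry P 0 k measurable_id
  rw [hmean] at h
  have hfst : MeasurePreserving Prod.fst (Dataset.law P Q)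
    (Measure.infinitePi fun p : ℕ × Fin K => P p.2) := measurePreserving_fst
  exact hfst.quasiMeasurePreserving.ae h

lemma integrable_armMean_comp {κ : Dataset K E → Fin K} (hκ : Measurable κ) :
    Integrable (fun D => armMean P (κ D)) (Dataset.law P Q) :=
  Integrable.of_bound ((measurable_of_finite (armMean P)).comp hκ).aestronglyMeasurable
    (∑ k, |armMean P k|) (ae_of_all _ fun D =>
      Finset.single_le_sum (f := fun k => |armMean P k|) (fun _ _ => abs_nonneg _)
        (Finset.mem_univ (κ D)))

-- The factor `g` sees only the external randomness and the seeds, which resampling keeps; the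
-- almost sure identity is used at both datasets.
variable {P Q} in
lemma Nonadaptive.ae_ae_setEntry_eq {β : Type*}
    {f : Dataset K E → β} (hf : Nonadaptive P Q f) (i : ℕ) (k : Fin K) :
    ∀ᵐ D ∂(Dataset.law P Q), ∀ᵐ x ∂(P k), f (D.setEntry i k x) = f D := by
  obtain ⟨g, hg⟩ := hf
  filter_upwards [hg, ae_ae_setEntry P Q hg i k] with D h1 h2
  filter_upwards [h2] with x h3
  rw [h3, h1]
  rfl

/-- The covariance of an entry and its weight has the sign of the monotonicity of the weight. -/
lemma mul_integral_entry_mul_nonneg {w : Dataset K E → ℝ}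
    (hw : Measurable w) (hw1 : ∀ D, |w D| ≤ 1) {i : ℕ} {k : Fin K}
    (hP : Integrable (fun y : ℝ => y) (P k)) (c : ℝ)
    (hmono : ∀ᵐ D ∂(Dataset.law P Q), ∀ᵐ x ∂(P k),
      D.1 (i, k) ≤ x → c * w D ≤ c * w (D.setEntry i k x)) :
    Integrable (fun D : Dataset K E => (D.1 (i, k) - armMean P k) * w D) (Dataset.law P Q) ∧
      0 ≤ c * ∫ D, (D.1 (i, k) - armMean P k) * w D ∂(Dataset.law P Q) := by
  have hfst : MeasurePreserving Prod.fst (Dataset.law P Q)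
    (Measure.infinitePi fun p : ℕ × Fin K => P p.2) := measurePreserving_fst
  have hX : Integrable (fun D : Dataset K E => D.1 (i, k) - armMean P k) (Dataset.law P Q) :=
    (((measurePreserving_entry P i k).comp hfst).integrable_comp_of_integrable hP).sub
      (integrable_const _)
  have hint : Integrable (fun D : Dataset K E => (D.1 (i, k) - armMean P k) * w D)
      (Dataset.law P Q) := hX.mul_bdd (c := 1) hw.aestronglyMeasurable (ae_of_all _ hw1)
  refine ⟨hint, ?_⟩
  have hset := measurePreserving_setEntry P Q i k
  have hD : ∀ (D : Dataset K E) (x y : ℝ),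
      (D.setEntry i k x).setEntry i k y = D.setEntry i k y := fun D x y => by
    simp [Dataset.setEntry]
  have hDx : ∀ (D : Dataset K E) (x : ℝ), (D.setEntry i k x).1 (i, k) = x := fun D x => by
    simp [Dataset.setEntry]
  -- The entry becomes a fresh variable `x`, independent of `D`, so the inner integral can be signed
  -- for fixed `D`.
  have hcomp : ∫ D, (D.1 (i, k) - armMean P k) * w D ∂(Dataset.law P Q) =
      ∫ D, ∫ x, (x - armMean P k) * w (D.setEntry i k x) ∂(P k) ∂(Dataset.law P Q) := by
    conv_lhs => rw [← hset.map_eq]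
    rw [integral_map hset.aemeasurable (by rw [hset.map_eq]; exact hint.aestronglyMeasurable)]
    refine (integral_prod _ (hset.integrable_comp_of_integrable hint)).trans ?_
    simp only [Function.comp_apply, hDx]
  rw [hcomp, ← integral_const_mul]
  refine integral_nonneg_of_ae ?_
  -- Monotonicity compares the value in `D` with a fresh draw. Resampling `D` first turns it into a
  -- comparison of two fresh draws `x`, `y`, as the association inequality needs.
  filter_upwards [ae_ae_setEntry P Q hmono i k] with D h
  simp only [hD, hDx] at h
  have hwD : Measurable fun x => c * w (D.setEntry i k x) :=
    (hw.comp (hset.measurable.comp measurable_prodMk_left)).const_mul c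
  have := integral_sub_mul_nonneg hP hwD (C := |c|) (fun x => by
    rw [abs_mul]
    exact mul_le_of_le_one_right (abs_nonneg _) (hw1 _)) h
  rw [Pi.zero_apply, ← integral_const_mul]
  refine this.trans_eq (integral_congr_ae (ae_of_all _ fun x => ?_))
  simp only [armMean]
  ring

end Data

/-! ### The error as a weighted sum of centred entries. -/

section Error

variable {K : ℕ} [NeZero K] {E : Type*} [MeasurableSpace E]
  (P : Fin K → Measure ℝ) (ν : SamplingRule K E) {T : Dataset K E → ℕ∞} {κ : Dataset K E → Fin K}

open Classical in
/-- The weight with which the entry `(i, k)` enters the sample mean of the chosen arm. -/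
noncomputable def SamplingRule.entryWeight (T : Dataset K E → ℕ∞) (κ : Dataset K E → Fin K)
    (i : ℕ) (k : Fin K) (D : Dataset K E) : ℝ :=
  -- Entries are numbered from `0`, so `(i, k)` is used exactly when `i < N_k(T)`. The cutoff also
  -- covers `N_k(T) = 0`, where the weight may be `∞`.
  if ν.countAt T k D ≤ i then 0 else (ν.weight T κ k D).toReal

open Classical in
/-- The estimation error of the chosen arm on the event that arm `k` is chosen. -/
noncomputable def SamplingRule.errorAt (T : Dataset K E → ℕ∞) (κ : Dataset K E → Fin K)
    (k : Fin K) (D : Dataset K E) : ℝ :=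
  if κ D = k then ν.meanAt T k D - armMean P k else 0

lemma sum_errorAt (D : Dataset K E) :
    ∑ k, ν.errorAt P T κ k D = ν.meanAt T (κ D) D - armMean P (κ D) := by
  simp [SamplingRule.errorAt]

/-- The partial sums of the weighted centred entries converge to the estimation error and are
dominated by the maximal deviation of the averages. -/
lemma tendsto_sum_entryWeight {k : Fin K} {D : Dataset K E} {G : ℝ}
    (hN : κ D = k → 1 ≤ ν.countAt T k D)
    (hG : ∀ n : ℕ, |∑ i ∈ Finset.range n, (D.1 (i, k) - armMean P k)| ≤ n * G)
    (hlim : Tendsto (fun n : ℕ => (∑ i ∈ Finset.range n, D.1 (i, k)) / (n : ℝ)) atTop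
      (𝓝 (armMean P k))) :
    (∀ n, |∑ i ∈ Finset.range n, (D.1 (i, k) - armMean P k) * ν.entryWeight T κ i k D| ≤ G) ∧
    Tendsto (fun n => ∑ i ∈ Finset.range n,
      (D.1 (i, k) - armMean P k) * ν.entryWeight T κ i k D) atTop
      (𝓝 (ν.errorAt P T κ k D)) := by
  have hG0 : 0 ≤ G := by simpa using (abs_nonneg _).trans (hG 1)
  by_cases hk : κ D = k
  swap
  · have hw : ∀ i, ν.entryWeight T κ i k D = 0 := fun i => by
      simp [SamplingRule.entryWeight, SamplingRule.weight, hk]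
    simp [hw, SamplingRule.errorAt, hk, hG0]
  rw [SamplingRule.errorAt, if_pos hk]
  by_cases htop : ν.countAt T k D = ⊤
  -- With infinitely many draws every weight is `1 / ∞ = 0`, and `hlim` makes the error zero as
  -- well.
  · have hw : ∀ i, ν.entryWeight T κ i k D = 0 := fun i => by
      simp [SamplingRule.entryWeight, SamplingRule.weight, htop]
    simp [hw, ν.meanAt_of_countAt_eq_top htop hlim, hG0]
  · obtain ⟨n, hn⟩ := ENat.ne_top_iff_exists.1 htop
    have hn1 : 1 ≤ n := by
      have := hN hk
      rw [← hn] at this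
      exact_mod_cast this
    have hn0 : (0 : ℝ) < n := by exact_mod_cast hn1
    have hw : ∀ i, ν.entryWeight T κ i k D = if i < n then (n : ℝ)⁻¹ else 0 := fun i => by
      rw [SamplingRule.entryWeight, SamplingRule.weight, if_pos hk, ← hn]
      by_cases hi : i < n
      · simp [hi, not_le.2 hi]
      · simp [hi, not_lt.1 hi]
    -- Only the first `n` entries carry weight, so the partial sums stop changing at `m = n`. Since
    -- `min m n ≤ n`, dividing by `n` leaves the bound `G`.
    have hsum : ∀ m, ∑ i ∈ Finset.range m,
        (D.1 (i, k) - armMean P k) * ν.entryWeight T κ i k D =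
        (∑ i ∈ Finset.range (min m n), (D.1 (i, k) - armMean P k)) / n := fun m => by
      have hr : Finset.range (min m n) = (Finset.range m).filter (· < n) := by
        ext i
        simp
      rw [hr, Finset.sum_filter, div_eq_mul_inv, Finset.sum_mul]
      refine Finset.sum_congr rfl fun i _ => ?_
      rw [hw]
      split_ifs <;> simp
    refine ⟨fun m => ?_, ?_⟩
    · rw [hsum, abs_div, Nat.abs_cast, div_le_iff₀ hn0, mul_comm]
      refine (hG _).trans ?_
      gcongr
      exact min_le_right _ _
    · refine tendsto_const_nhds.congr' ?_
      filter_upwards [eventually_ge_atTop n] with m hm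
      rw [hsum, min_eq_right hm, ν.meanAt_of_countAt_eq_natCast hn.symm, Finset.sum_sub_distrib,
        Finset.sum_const, Finset.card_range, nsmul_eq_mul]
      field_simp

end Error

/-! ### The sign of the bias. -/

section Bias

variable {K : ℕ} [NeZero K] {E : Type*} [MeasurableSpace E]
  (P : Fin K → Measure ℝ) [∀ k, IsProbabilityMeasure (P k)] (Q : Measure E)
  (ν : SamplingRule K E) {T : Dataset K E → ℕ∞} {κ : Dataset K E → Fin K}

lemma weight_le_one {k : Fin K} {D : Dataset K E} {i : ℕ} (h : ¬ ν.countAt T k D ≤ i) :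
    ν.weight T κ k D ≤ 1 := by
  rw [SamplingRule.weight]
  split_ifs
  · refine ENNReal.inv_le_one.2 ?_
    have : (1 : ℕ∞) ≤ ν.countAt T k D :=
      Order.one_le_iff_pos.2 (bot_le.trans_lt (not_le.1 h))
    exact_mod_cast this
  · exact zero_le_one

lemma abs_entryWeight_le_one (i : ℕ) (k : Fin K) (D : Dataset K E) :
    |ν.entryWeight T κ i k D| ≤ 1 := by
  rw [SamplingRule.entryWeight]
  split_ifs with h
  · simp
  · rw [abs_of_nonneg ENNReal.toReal_nonneg]
    exact ENNReal.toReal_le_of_le_ofReal zero_le_one (by simpa using weight_le_one ν h)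

lemma measurable_entryWeight (hT : Measurable T) (hκ : Measurable κ) (i : ℕ) (k : Fin K) :
    Measurable (ν.entryWeight T κ i k) :=
  Measurable.ite (ν.measurable_countAt hT k (MeasurableSet.of_discrete (s := Set.Iic (i : ℕ∞))))
    measurable_const (ν.measurable_weight hT hκ k).ennreal_toReal

/-- The cutoff in `entryWeight` is therefore constant in its own entry, and monotonicity passes from
`weight` to `entryWeight`. -/
lemma countAt_setEntry_le_iff (hT : IsStoppingTime ν.filtration T) (D : Dataset K E) (i : ℕ)
    (k : Fin K) (x : ℝ) :
    ν.countAt T k (D.setEntry i k x) ≤ i ↔ ν.countAt T k D ≤ i := by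
  have h : ∀ j, j ≠ (i, k) → (D.setEntry i k x).1 j = D.1 j := fun j hj =>
    Function.update_of_ne hj _ _
  exact ⟨ν.countAt_le_of_countAt_le hT rfl fun j hj => (h j hj).symm,
    ν.countAt_le_of_countAt_le hT rfl h⟩

lemma entryWeight_setEntry_le (hT : IsStoppingTime ν.filtration T) {D : Dataset K E} {i : ℕ}
    {k : Fin K} {x : ℝ} (h : ν.weight T κ k (D.setEntry i k x) ≤ ν.weight T κ k D) :
    ν.entryWeight T κ i k (D.setEntry i k x) ≤ ν.entryWeight T κ i k D := by
  simp only [SamplingRule.entryWeight, countAt_setEntry_le_iff ν hT]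
  split_ifs with hc
  · exact le_rfl
  · exact ENNReal.toReal_mono ((weight_le_one ν hc).trans_lt ENNReal.one_lt_top).ne h

lemma le_entryWeight_setEntry (hT : IsStoppingTime ν.filtration T) {D : Dataset K E} {i : ℕ}
    {k : Fin K} {x : ℝ} (h : ν.weight T κ k D ≤ ν.weight T κ k (D.setEntry i k x)) :
    ν.entryWeight T κ i k D ≤ ν.entryWeight T κ i k (D.setEntry i k x) := by
  simp only [SamplingRule.entryWeight, countAt_setEntry_le_iff ν hT]
  split_ifs with hc
  · exact le_rfl
  -- The finiteness that `ENNReal.toReal_mono` asks for concerns the larger weight, which here is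
  -- the one after the replacement.
  · rw [← countAt_setEntry_le_iff ν hT D i k x] at hc
    exact ENNReal.toReal_mono ((weight_le_one ν hc).trans_lt ENNReal.one_lt_top).ne h

/-- Dominated convergence with the integrable bound on the centred averages; this is where moments
of `N_k(T)` are avoided. -/
lemma integrable_errorAt [IsProbabilityMeasure Q] (hT : Measurable T) (hκ : Measurable κ)
    {k : Fin K} (hP : MemLp (fun y : ℝ => y) 2 (P k))
    (hN : ∀ᵐ D ∂(Dataset.law P Q), κ D = k → 1 ≤ ν.countAt T k D) :
    Integrable (ν.errorAt P T κ k) (Dataset.law P Q) ∧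
    Tendsto (fun n => ∑ i ∈ Finset.range n, ∫ D,
      (D.1 (i, k) - armMean P k) * ν.entryWeight T κ i k D ∂(Dataset.law P Q)) atTop
      (𝓝 (∫ D, ν.errorAt P T κ k D ∂(Dataset.law P Q))) := by
  have hP1 : Integrable (fun y : ℝ => y) (P k) := hP.integrable one_le_two
  obtain ⟨G, hG, hGle⟩ := exists_integrable_abs_sum_entry_le P Q hP
  have hint : ∀ i, Integrable (fun D : Dataset K E =>
      (D.1 (i, k) - armMean P k) * ν.entryWeight T κ i k D) (Dataset.law P Q) := fun i =>
    -- Only integrability is wanted, and `c = 0` makes the monotonicity condition trivial.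
    (mul_integral_entry_mul_nonneg P Q (measurable_entryWeight ν hT hκ i k)
      (abs_entryWeight_le_one ν i k) hP1 0 (by simp)).1
  have hsum := fun n => integrable_finsetSum (Finset.range n) fun i _ => hint i
  have hae : ∀ᵐ D ∂(Dataset.law P Q), (∀ n, |∑ i ∈ Finset.range n,
      (D.1 (i, k) - armMean P k) * ν.entryWeight T κ i k D| ≤ G D) ∧
    Tendsto (fun n => ∑ i ∈ Finset.range n,
      (D.1 (i, k) - armMean P k) * ν.entryWeight T κ i k D) atTop
      (𝓝 (ν.errorAt P T κ k D)) := by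
    filter_upwards [hN, hGle, ae_tendsto_average_entry P Q hP1] with D h1 h2 h3
    exact tendsto_sum_entryWeight P ν h1 h2 h3
  -- Measurability comes from the limit of the partial sums, which bypasses the `limUnder` in
  -- `meanAt`.
  have hmeas : AEStronglyMeasurable (ν.errorAt P T κ k) (Dataset.law P Q) :=
    aestronglyMeasurable_of_tendsto_ae atTop (fun n => (hsum n).aestronglyMeasurable)
      (hae.mono fun D h => h.2)
  refine ⟨hG.mono' hmeas (hae.mono fun D h => le_of_tendsto h.2.abs (.of_forall h.1)), ?_⟩
  have := tendsto_integral_of_dominated_convergence G (fun n => (hsum n).aestronglyMeasurable)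
    hG (fun n => hae.mono fun D h => h.1 n) (hae.mono fun D h => h.2)
  simpa only [integral_finsetSum _ fun i _ => hint i] using this

lemma mul_integral_errorAt_nonneg [IsProbabilityMeasure Q] (hT : Measurable T)
    (hκ : Measurable κ) {k : Fin K} (hP : MemLp (fun y : ℝ => y) 2 (P k))
    (hN : ∀ᵐ D ∂(Dataset.law P Q), κ D = k → 1 ≤ ν.countAt T k D) (c : ℝ)
    (hmono : ∀ i, ∀ᵐ D ∂(Dataset.law P Q), ∀ᵐ x ∂(P k), D.1 (i, k) ≤ x →
      c * ν.entryWeight T κ i k D ≤ c * ν.entryWeight T κ i k (D.setEntry i k x)) :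
    0 ≤ c * ∫ D, ν.errorAt P T κ k D ∂(Dataset.law P Q) := by
  refine ge_of_tendsto ((integrable_errorAt P Q ν hT hκ hP hN).2.const_mul c)
    (.of_forall fun n => ?_)
  rw [Finset.mul_sum]
  exact Finset.sum_nonneg fun i _ => (mul_integral_entry_mul_nonneg P Q
    (measurable_entryWeight ν hT hκ i k) (abs_entryWeight_le_one ν i k)
    (hP.integrable one_le_two) c (hmono i)).2

/-- The conditional bias is the integral of the error divided by the probability of `κ = k`, so both
have the same sign. -/
lemma integral_cond_meanAt [IsProbabilityMeasure Q] (hκ : Measurable κ) {k : Fin K}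
    (hk : 0 < Dataset.law P Q {D | κ D = k})
    (hint : Integrable (ν.errorAt P T κ k) (Dataset.law P Q)) :
    ∫ D, ν.meanAt T (κ D) D ∂((Dataset.law P Q)[|{D | κ D = k}]) = armMean P k +
      ((Dataset.law P Q).real {D | κ D = k})⁻¹ *
        ∫ D, ν.errorAt P T κ k D ∂(Dataset.law P Q) := by
  have hA : MeasurableSet {D | κ D = k} := hκ (measurableSet_singleton k)
  have hr : (Dataset.law P Q).real {D | κ D = k} ≠ 0 :=
    (ENNReal.toReal_pos hk.ne' (measure_ne_top _ _)).ne'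
  have h1 : ∫ D in {D | κ D = k}, ν.meanAt T (κ D) D ∂(Dataset.law P Q) =
      ∫ D in {D | κ D = k}, (armMean P k + ν.errorAt P T κ k D) ∂(Dataset.law P Q) := by
    refine setIntegral_congr_fun hA fun D hD => ?_
    have hD : κ D = k := hD
    simp [SamplingRule.errorAt, hD]
  have h2 : ∫ D in {D | κ D = k}, ν.errorAt P T κ k D ∂(Dataset.law P Q) =
      ∫ D, ν.errorAt P T κ k D ∂(Dataset.law P Q) :=
    setIntegral_eq_integral_of_forall_compl_eq_zero fun D hD => if_neg hD
  rw [ProbabilityTheory.cond, integral_smul_measure, h1,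
    integral_add (integrable_const _) hint.integrableOn, h2, setIntegral_const, ENNReal.toReal_inv,
    smul_eq_mul, smul_eq_mul, mul_add, ← mul_assoc]
  congr 1
  rw [← measureReal_def, inv_mul_cancel₀ hr, one_mul]

/-- The factor `c` treats both directions at once: `c = -1` for decreasing and `c = 1` for
increasing strategies. -/
lemma bias_sign [IsProbabilityMeasure Q] (hT : IsStoppingTime ν.filtration T)
    (hκ : Measurable κ) (hP : ∀ k, MemLp (fun y : ℝ => y) 2 (P k))
    (hN : ∀ k, ∀ᵐ D ∂(Dataset.law P Q), κ D = k → 1 ≤ ν.countAt T k D) (c : ℝ)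
    (hmono : ∀ i k, ∀ᵐ D ∂(Dataset.law P Q), ∀ᵐ x ∂(P k), D.1 (i, k) ≤ x →
      c * ν.entryWeight T κ i k D ≤ c * ν.entryWeight T κ i k (D.setEntry i k x)) :
    (∀ k, 0 < Dataset.law P Q {D | κ D = k} →
      0 ≤ c * (∫ D, ν.meanAt T (κ D) D ∂((Dataset.law P Q)[|{D | κ D = k}]) - armMean P k)) ∧
    0 ≤ c * ∫ D, (ν.meanAt T (κ D) D - armMean P (κ D)) ∂(Dataset.law P Q) := by
  have hTm := ν.measurable_of_isStoppingTime hT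
  have hint := fun k => (integrable_errorAt P Q ν hTm hκ (hP k) (hN k)).1
  have hnn := fun k => mul_integral_errorAt_nonneg P Q ν hTm hκ (hP k) (hN k) c (hmono · k)
  refine ⟨fun k hk => ?_, ?_⟩
  · rw [integral_cond_meanAt P Q ν hκ hk (hint k), add_sub_cancel_left, mul_left_comm]
    exact mul_nonneg (inv_nonneg.2 measureReal_nonneg) (hnn k)
  · simp_rw [← sum_errorAt P ν]
    rw [integral_finsetSum _ fun k _ => hint k, Finset.mul_sum]
    exact Finset.sum_nonneg fun k _ => hnn k

lemma weight_anti {k : Fin K} {D D' : Dataset K E} (hκ : κ D' = κ D)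
    (h : ν.countAt T k D ≤ ν.countAt T k D') : ν.weight T κ k D' ≤ ν.weight T κ k D := by
  rw [SamplingRule.weight, SamplingRule.weight, hκ]
  split_ifs
  · exact ENNReal.inv_le_inv.2 (by exact_mod_cast h)
  · exact le_rfl

/-! ### Optimistic rules yield monotone strategies. -/

variable {P Q}

lemma NonadaptiveSampling.ae_ae_count_setEntry_eq [IsProbabilityMeasure Q]
    (hν : NonadaptiveSampling P Q ν) (i : ℕ) (k : Fin K) :
    ∀ᵐ D ∂(Dataset.law P Q), ∀ᵐ x ∂(P k), ∀ t,
      ν.count k t (D.setEntry i k x) = ν.count k t D := by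
  filter_upwards [ae_all_iff.2 fun t => (hν t).ae_ae_setEntry_eq i k] with D h
  filter_upwards [ae_all_iff.2 h] with x hx t
  simp only [SamplingRule.count, hx]

lemma MonotonicallyDecreasing.of_optimisticSampling [IsProbabilityMeasure Q]
    (hν : OptimisticSampling P Q ν) (hT : Nonadaptive P Q T) (hκ : Nonadaptive P Q κ) :
    MonotonicallyDecreasing P Q ν T κ := fun i k => by
  filter_upwards [ae_all_iff.2 fun t => hν i t k, hT.ae_ae_setEntry_eq i k,
    hκ.ae_ae_setEntry_eq i k] with D h1 h2 h3
  filter_upwards [ae_all_iff.2 h1, h2, h3] with x h1 h2 h3 hx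
  exact weight_anti ν h3 (ν.countAt_mono h2.ge fun t => h1 t hx)

lemma MonotonicallyIncreasing.of_optimisticStopping [IsProbabilityMeasure Q]
    (hT : OptimisticStopping P Q T) (hν : NonadaptiveSampling P Q ν)
    (hκ : Nonadaptive P Q κ) : MonotonicallyIncreasing P Q ν T κ := fun i k => by
  filter_upwards [hT i k, NonadaptiveSampling.ae_ae_count_setEntry_eq ν hν i k,
    hκ.ae_ae_setEntry_eq i k] with D h1 h2 h3
  filter_upwards [h1, h2, h3] with x h1 h2 h3 hx
  exact weight_anti ν h3.symm (ν.countAt_mono (h1 hx) fun t => (h2 t).le)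

lemma MonotonicallyIncreasing.of_optimisticChoosing [IsProbabilityMeasure Q]
    (hκ : OptimisticChoosing P Q κ) (hν : NonadaptiveSampling P Q ν)
    (hT : Nonadaptive P Q T) : MonotonicallyIncreasing P Q ν T κ := fun i k => by
  filter_upwards [hκ i k, NonadaptiveSampling.ae_ae_count_setEntry_eq ν hν i k,
    hT.ae_ae_setEntry_eq i k] with D h1 h2 h3
  filter_upwards [h1, h2, h3] with x h1 h2 h3 hx
  have hc : ν.countAt T k (D.setEntry i k x) = ν.countAt T k D :=
    le_antisymm (ν.countAt_mono h3.le fun t => (h2 t).le)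
      (ν.countAt_mono h3.ge fun t => (h2 t).ge)
  have h1 := h1 hx
  rw [SamplingRule.weight, SamplingRule.weight, hc]
  -- The counts agree, so only the indicator matters. If arm `k` was chosen, `h1` keeps it chosen;
  -- otherwise the weight at `D` is zero.
  by_cases hk : κ D = k
  · by_cases hk' : κ (D.setEntry i k x) = k
    · simp [hk, hk']
    · simp [hk, hk'] at h1
  · simp [hk]

end Bias

end Bandit

theorem mainTheorem6 {K : ℕ} [NeZero K] {E : Type*} [MeasurableSpace E]
    (P : Fin K → Measure ℝ) [∀ k, IsProbabilityMeasure (P k)]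
    (Q : Measure E) [IsProbabilityMeasure Q]
    (ν : Bandit.SamplingRule K E)
    (T : Bandit.Dataset K E → ℕ∞) (hT : IsStoppingTime ν.filtration T)
    (κ : Bandit.Dataset K E → Fin K) (hκ : Measurable[hT.measurableSpace] κ)
    (p : ℝ) (hp : 2 < p) (hP : ∀ k, MemLp (fun y : ℝ => y) (ENNReal.ofReal p) (P k))
    (hN : ∀ k, 0 < Bandit.Dataset.law P Q {D | κ D = k} →
      ∀ᵐ D ∂(Bandit.Dataset.law P Q), 1 ≤ ν.countAt T k D) :
    Integrable (fun D => ν.meanAt T (κ D) D) (Bandit.Dataset.law P Q) ∧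
    ((Bandit.MonotonicallyDecreasing P Q ν T κ ∨
        (Bandit.OptimisticSampling P Q ν ∧
          Bandit.Nonadaptive P Q T ∧ Bandit.Nonadaptive P Q κ)) →
      (∀ k, 0 < Bandit.Dataset.law P Q {D | κ D = k} →
        ∫ D, ν.meanAt T (κ D) D ∂((Bandit.Dataset.law P Q)[|{D | κ D = k}]) ≤
          Bandit.armMean P k) ∧
      ∫ D, (ν.meanAt T (κ D) D - Bandit.armMean P (κ D)) ∂(Bandit.Dataset.law P Q) ≤ 0) ∧
    ((Bandit.MonotonicallyIncreasing P Q ν T κ ∨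
        (Bandit.OptimisticStopping P Q T ∧
          Bandit.NonadaptiveSampling P Q ν ∧ Bandit.Nonadaptive P Q κ) ∨
        (Bandit.OptimisticChoosing P Q κ ∧
          Bandit.NonadaptiveSampling P Q ν ∧ Bandit.Nonadaptive P Q T)) →
      (∀ k, 0 < Bandit.Dataset.law P Q {D | κ D = k} →
        Bandit.armMean P k ≤
          ∫ D, ν.meanAt T (κ D) D ∂((Bandit.Dataset.law P Q)[|{D | κ D = k}])) ∧
      0 ≤ ∫ D, (ν.meanAt T (κ D) D - Bandit.armMean P (κ D)) ∂(Bandit.Dataset.law P Q)) := by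
  open Bandit in
  have hκm : Measurable κ := hκ.mono hT.measurableSpace_le le_rfl
  have hTm := ν.measurable_of_isStoppingTime hT
  have hP2 : ∀ k, MemLp (fun y : ℝ => y) 2 (P k) := fun k => (hP k).mono_exponent <| by
    rw [← ENNReal.ofReal_ofNat]
    exact ENNReal.ofReal_le_ofReal hp.le
  -- Arms of probability zero satisfy the implication vacuously almost surely, so all arms can be
  -- summed over.
  have hN' : ∀ k, ∀ᵐ D ∂(Dataset.law P Q), κ D = k → 1 ≤ ν.countAt T k D := fun k => by
    rcases eq_zero_or_pos (Dataset.law P Q {D | κ D = k}) with h0 | h0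
    · have : ∀ᵐ D ∂(Dataset.law P Q), κ D ≠ k := by
        rw [ae_iff]
        simpa using h0
      filter_upwards [this] with D hD hk using absurd hk hD
    · filter_upwards [hN k h0] with D hD _ using hD
  refine ⟨?_, fun h => ?_, fun h => ?_⟩
  · have h := (integrable_finsetSum Finset.univ fun k _ =>
      (integrable_errorAt P Q ν hTm hκm (hP2 k) (hN' k)).1).add (integrable_armMean_comp P Q hκm)
    refine h.congr (ae_of_all _ fun D => ?_)
    simp [sum_errorAt P ν]
  · have hd : MonotonicallyDecreasing P Q ν T κ := by
      rcases h with h | ⟨h1, h2, h3⟩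
      · exact h
      · exact .of_optimisticSampling ν h1 h2 h3
    obtain ⟨h1, h2⟩ := bias_sign P Q ν hT hκm hP2 hN' (-1) fun i k => by
      filter_upwards [hd i k] with D h
      filter_upwards [h] with x h hx
      linarith [entryWeight_setEntry_le ν hT (h hx)]
    exact ⟨fun k hk => by linarith [h1 k hk], by linarith⟩
  · have hi : MonotonicallyIncreasing P Q ν T κ := by
      rcases h with h | ⟨h1, h2, h3⟩ | ⟨h1, h2, h3⟩
      · exact h
      · exact .of_optimisticStopping ν h1 h2 h3
      · exact .of_optimisticChoosing ν h1 h2 h3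
    obtain ⟨h1, h2⟩ := bias_sign P Q ν hT hκm hP2 hN' 1 fun i k => by
      filter_upwards [hi i k] with D h
      filter_upwards [h] with x h hx
      linarith [le_entryWeight_setEntry ν hT (h hx)]
    exact ⟨fun k hk => by linarith [h1 k hk], by linarith⟩
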